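/- **Theorem.** Let $r\in(0,2)$ and let $L:(1,\infty)\to(0,\infty)$ be continuous and slowly varying at infinity, i.e. $L(cy)/L(y)\to1$ as $y\to\infty$ for every $c>0$. For a random variable $\eta$ write $T_\eta(x)=\mathbf P(|\eta|\ge x)$ and $\psi_\eta(t)=1-\operatorname{Re}\mathbf E e^{it\eta}$. Let $\gamma\in\mathbb R$, let $\xi$ be a random variable with symmetric distribution such that $$T_\xi(x)=x^{-r}(\log x)^{\gamma}L(\log x)\qquad\text{for all }x>e,$$ and put $T=T_\xi$, $\psi=\psi_\xi$. Suppose that * (RT) there are $C_1>0$ and $a_0>0$ such that $T(2/a)\ge C_1a^{-1}\int_{-a}^{a}\psi(t)\,dt$ for all $a\in(0,a_0)$; * (MD) there is $\Delta>0$ such that for every $t\in[0,\Delta)$ the function $\lambda\mapsto\psi(\lambda t)/\psi(\lambda)$ is non-decreasing on $(0,1)$ (that is, it decreases as $\lambda$ decreases to $0$). Let $\xi(1),\xi(2),\dots$ be independent copies of $\xi$, and let $b(1)=1,b(2),b(3),\dots$ be a natural norming sequence: positive numbers with $b(n)\to\infty$ and $\psi(1/b(n))=1/n$ for every $n\ge2$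 for which the equation $\psi(1/s)=1/n$ has a solution $s>0$ (for the finitely many other $n$, $b(n)>0$ is arbitrary). Put $$S(n)=\frac1{b(n)}\sum_{k=1}^n\xi(k),\qquad U(x)=\sup_{n\ge1}\mathbf P(|S(n)|\ge x).$$ Then there is $x_0>1$ such that $$T(x)\le U(x)\le C\,T(x)\qquad\text{for all }x>x_0,$$ so the upper bound cannot be improved by more than a constant factor. Here $C$ depends only on $r$, $L$ and a positive lower bound $\beta$ of the sequence $b$ (such a $\beta$ always exists); in particular $C=C(r,L)$ for all natural norming sequences with $b(n)\ge1$ for all $n$. The number $x_0$ may depend on the law of $\xi$ and on $b$. -/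

import Mathlib

open MeasureTheory ProbabilityTheory Filter Topology

noncomputable section

/-- The two-sided tail function `T_η(x) = P(|η| ≥ x)`. -/
def tailFn {Ω : Type*} [MeasurableSpace Ω] (P : Measure Ω) (η : Ω → ℝ) (x : ℝ) : ℝ :=
  P.real {ω | x ≤ |η ω|}

/-- `ψ_η(t) = 1 - Re E exp(i t η)`. -/
def psi {Ω : Type*} [MeasurableSpace Ω] (P : Measure Ω) (η : Ω → ℝ) (t : ℝ) : ℝ :=
  1 - (charFun (P.map η) t).re

/-- `L` is slowly varying at infinity. -/
def SlowlyVarying (L : ℝ → ℝ) : Prop :=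
  ∀ c : ℝ, 0 < c → Tendsto (fun y => L (c * y) / L y) atTop (𝓝 1)

/-- `T_η(x) = x^{-r} (log x)^γ L(log x)` for all `x > e`. -/
def HasLogTail {Ω : Type*} [MeasurableSpace Ω] (P : Measure Ω) (η : Ω → ℝ)
    (r γ : ℝ) (L : ℝ → ℝ) : Prop :=
  ∀ x : ℝ, Real.exp 1 < x →
    tailFn P η x = x ^ (-r) * (Real.log x) ^ γ * L (Real.log x)

/-- The class `RT` of laws with a regular tail: for some `C₁ > 0` and all sufficiently small
`a > 0`, `T_η(2/a) ≥ C₁ a⁻¹ ∫_{-a}^{a} ψ_η(t) dt`. -/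
def RegularTail {Ω : Type*} [MeasurableSpace Ω] (P : Measure Ω) (η : Ω → ℝ) : Prop :=
  ∃ C₁ : ℝ, 0 < C₁ ∧ ∃ a₀ : ℝ, 0 < a₀ ∧ ∀ a : ℝ, 0 < a → a < a₀ →
    C₁ * (a⁻¹ * ∫ t in (-a)..a, psi P η t) ≤ tailFn P η (2 / a)

/-- The class `MD`: for all `t` in some `[0, Δ)` the ratio `ψ(λ t) / ψ(λ)` decreases as `λ ∈ (0,1)`
decreases from `1` to `0`, so that its supremum over `λ ∈ (0,1)` is the value at `λ = 1`, i.e. is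
`ψ(t)` up to the constant factor `1 / ψ(1)`. (This is the direction that holds for the tails
`x^{-r} (log x)^γ` with `γ > 0`.) -/
def ClassMD {Ω : Type*} [MeasurableSpace Ω] (P : Measure Ω) (η : Ω → ℝ) : Prop :=
  ∃ Δ : ℝ, 0 < Δ ∧ ∀ t ∈ Set.Ico (0 : ℝ) Δ,
    MonotoneOn (fun l : ℝ => psi P η (l * t) / psi P η l) (Set.Ioo 0 1)

/-- `b(1), b(2), …` is a natural norming sequence for `η`: positive, `b(1) = 1`, `b(n) → ∞`, and
`ψ_η(1/b(n)) = 1/n` for every `n ≥ 2` for which this equation can be solved at all. (It can for all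
large `n`; for the finitely many remaining `n` the positive number `b(n)` is arbitrary.
The value `b 0` is never used.) -/
structure IsNaturalNorming {Ω : Type*} [MeasurableSpace Ω] (P : Measure Ω) (η : Ω → ℝ)
    (b : ℕ → ℝ) : Prop where
  pos : ∀ n : ℕ, 1 ≤ n → 0 < b n
  one : b 1 = 1
  eqn : ∀ n : ℕ, 2 ≤ n → (∃ s : ℝ, 0 < s ∧ psi P η (1 / s) = 1 / (n : ℝ)) →
    psi P η (1 / b n) = 1 / (n : ℝ)
  tendsto : Tendsto b atTop atTop

/-- `S(n) = b(n)⁻¹ (X 0 + ⋯ + X (n-1))`. -/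
def normedSum {Ω : Type*} (X : ℕ → Ω → ℝ) (b : ℕ → ℝ) (n : ℕ) (ω : Ω) : ℝ :=
  (b n)⁻¹ * ∑ k ∈ Finset.range n, X k ω

/-- The uniform tail function `U(x) = sup_{n ≥ 1} T_{S(n)}(x)`; the supremum is over a nonempty
set of numbers in `[0, 1]` when `P` is a probability measure. -/
def uniformTail {Ω : Type*} [MeasurableSpace Ω] (P : Measure Ω) (X : ℕ → Ω → ℝ)
    (b : ℕ → ℝ) (x : ℝ) : ℝ :=
  ⨆ n : ℕ+, tailFn P (normedSum X b n) x

end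

/-! The lower bound is the term `n = 1`, since `b 1 = 1`. For the upper bound, the truncation
inequality for characteristic functions and `|1 - z ^ n| ≤ n |1 - z|` for `|z| ≤ 1` bound the tail
of `S(n)` at `x` by twice the supremum of `n ψ(t / b(n))` over `|t| ≤ 4 / x`
(`tailFn_normedSum_le_integral`). As `n = 1 / ψ(1 / b(n))`, this is a ratio `ψ(λ t) / ψ(λ)` with `λ
= 1 / b(n)`, and for `λ < 1` the class `MD` bounds it by `ψ(t) / ψ(1)`, in which `n` no longer
occurs (`ClassMD.exists_div_le`). Then `ψ(t)` is at most twice a truncated second moment at level `x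
/ 4`, which for `r < 2` is of the order of `T(x)` by a Karamata argument
(`HasLogTail.eventually_truncMoment_le`). The finitely many small `n` are left to the union bound
and regular variation.

The delicate point is that `C` must not depend on `γ` or on the law. Both `ψ(1)` and the threshold
for small `n` enter through a lower bound `κ` for `ψ` on a compact set of frequencies. Here `γ`
ranges over a compact interval: `MD` forces `γ ≥ 0`, and a tail at most one at `exp 2` bounds `γ`
above. Compactness in exponent and frequency then gives `κ` in terms of `r`, `L` and `β`
(`exists_pos_le_psi`). -/

/-! ### Slow and regular variation. -/

/-- Uniform convergence theorem for additively slowly varying continuous functions. -/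
theorem tendsto_comp_add_sub_of_tendsto_zero {f : ℝ → ℝ} (hf : Continuous f)
    (h : ∀ v, Tendsto (fun u => f (u + v) - f u) atTop (𝓝 0)) {δ : ℝ → ℝ}
    (hδ : Tendsto δ atTop (𝓝 0)) : Tendsto (fun u => f (u + δ u) - f u) atTop (𝓝 0) := by
  rw [Metric.tendsto_atTop]
  intro ε hε
  set E : ℕ → Set ℝ := fun n => {v | ∀ u : ℝ, (n : ℝ) ≤ u → |f (u + v) - f u| ≤ ε / 3} with hE
  have hclosed : ∀ n, IsClosed (E n) := by
    intro n
    have : E n = ⋂ u : ℝ, ⋂ _ : (n : ℝ) ≤ u, {v | |f (u + v) - f u| ≤ ε / 3} := by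
      ext v; simp [hE]
    rw [this]
    refine isClosed_iInter fun u => isClosed_iInter fun _ => ?_
    exact isClosed_le (by fun_prop) continuous_const
  have hunion : ⋃ n, E n = Set.univ := by
    refine Set.eq_univ_of_forall fun v => ?_
    obtain ⟨N, hN⟩ := (Metric.tendsto_atTop.1 (h v)) (ε / 3) (by positivity)
    obtain ⟨n, hn⟩ := exists_nat_ge N
    refine Set.mem_iUnion.2 ⟨n, fun u hu => ?_⟩
    have := hN u (hn.trans hu)
    rw [Real.dist_eq, sub_zero] at this
    exact this.le
  -- By Baire some `E n` contains a ball around a `v`. Seen from the base point `u - v`, both `u`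
  -- and `u + δ u` are shifts by elements of that ball.
  obtain ⟨n, v, hv⟩ := nonempty_interior_of_iUnion_of_closed hclosed hunion
  obtain ⟨η, hη, hball⟩ := Metric.mem_nhds_iff.1 (mem_interior_iff_mem_nhds.1 hv)
  obtain ⟨N, hN⟩ := (Metric.tendsto_atTop.1 hδ) η hη
  refine ⟨max N (n + v), fun u hu => ?_⟩
  have h1 : v + δ u ∈ E n := by
    apply hball
    have := hN u ((le_max_left _ _).trans hu)
    rw [Metric.mem_ball, Real.dist_eq]
    rw [Real.dist_eq, sub_zero] at this
    simpa using this
  have h2 : v ∈ E n := hball (Metric.mem_ball_self hη)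
  have hun : (n : ℝ) ≤ u - v := by linarith [(le_max_right N (n + v)).trans hu]
  have h3 := h1 _ hun
  have h4 := h2 _ hun
  rw [show u - v + (v + δ u) = u + δ u by ring] at h3
  rw [show u - v + v = u by ring] at h4
  rw [Real.dist_eq, sub_zero]
  rw [abs_le] at h3 h4
  rw [abs_lt]
  constructor <;> linarith

/-- In the variable `u = log y`, adding `c` to `y` is a shift by `log (1 + c / y)`, which tends to
zero but varies with `y`; hence the appeal to uniform convergence. It is needed because `log (c * x)
= log x + log c` is the argument of `L` in the tail at `c * x`. -/
theorem SlowlyVarying.tendsto_add_div {L : ℝ → ℝ} (hLpos : ∀ y : ℝ, 1 < y → 0 < L y)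
    (hLcont : ContinuousOn L (Set.Ioi 1)) (hLslow : SlowlyVarying L) (c : ℝ) :
    Tendsto (fun y => L (y + c) / L y) atTop (𝓝 1) := by
  -- The cut-off `max u 1` keeps the argument of `L` in `(1, ∞)`, so that `f` is continuous on the
  -- whole line.
  set f : ℝ → ℝ := fun u => Real.log (L (Real.exp (max u 1))) with hfdef
  have hgt : ∀ u : ℝ, 1 < Real.exp (max u 1) := fun u =>
    Real.one_lt_exp_iff.2 (lt_of_lt_of_le one_pos (le_max_right _ _))
  have hf : Continuous f := by
    refine Continuous.log ?_ fun u => (hLpos _ (hgt u)).ne'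
    exact hLcont.comp_continuous (by fun_prop) hgt
  have hfexp : ∀ u : ℝ, 1 ≤ u → f u = Real.log (L (Real.exp u)) := fun u hu => by
    simp only [hfdef, max_eq_left hu]
  have hadd : ∀ v, Tendsto (fun u => f (u + v) - f u) atTop (𝓝 0) := by
    intro v
    have h1 := (hLslow (Real.exp v) (Real.exp_pos v)).comp Real.tendsto_exp_atTop
    have h2 := (Real.continuousAt_log one_ne_zero).tendsto.comp h1
    rw [Real.log_one] at h2
    refine h2.congr' ?_
    filter_upwards [eventually_ge_atTop (1 : ℝ), eventually_ge_atTop (1 - v)] with u hu huv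
    have huv' : 1 ≤ u + v := by linarith
    rw [hfexp u hu, hfexp _ huv']
    simp only [Function.comp]
    rw [← Real.exp_add, add_comm v u, Real.log_div]
    · exact (hLpos _ (Real.one_lt_exp_iff.2 (by linarith))).ne'
    · exact (hLpos _ (Real.one_lt_exp_iff.2 (by linarith))).ne'
  have hδ : Tendsto (fun u : ℝ => Real.log (1 + c * Real.exp (-u))) atTop (𝓝 0) := by
    have h1 : Tendsto (fun u : ℝ => 1 + c * Real.exp (-u)) atTop (𝓝 (1 + c * 0)) :=
      (Real.tendsto_exp_neg_atTop_nhds_zero.const_mul c).const_add 1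
    rw [mul_zero, add_zero] at h1
    have := (Real.continuousAt_log one_ne_zero).tendsto.comp h1
    rwa [Real.log_one] at this
  have h1 := (tendsto_comp_add_sub_of_tendsto_zero hf hadd hδ).comp Real.tendsto_log_atTop
  have h2 := (Real.continuous_exp.tendsto 0).comp h1
  rw [Real.exp_zero] at h2
  refine h2.congr' ?_
  filter_upwards [eventually_ge_atTop (Real.exp 1), eventually_ge_atTop (Real.exp 1 - c)]
    with y hy hyc
  have he : 1 < Real.exp 1 := Real.one_lt_exp_iff.2 one_pos
  have hy0 : 0 < y := by linarith
  have hyc0 : 0 < y + c := by linarith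
  have e1 : Real.log y + Real.log (1 + c * Real.exp (-Real.log y)) = Real.log (y + c) := by
    rw [Real.exp_neg, Real.exp_log hy0, show 1 + c * y⁻¹ = (y + c) / y by field_simp,
      Real.log_div hyc0.ne' hy0.ne']
    ring
  have l1 : 1 ≤ Real.log y := (Real.le_log_iff_exp_le hy0).2 hy
  have l2 : 1 ≤ Real.log (y + c) := (Real.le_log_iff_exp_le hyc0).2 (by linarith)
  simp only [Function.comp]
  rw [e1, hfexp _ l1, hfexp _ l2, Real.exp_log hy0, Real.exp_log hyc0, Real.exp_sub,
    Real.exp_log (hLpos _ (by linarith)), Real.exp_log (hLpos _ (by linarith))]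

/-- The function `x^{-r} (log x)^γ L(log x)`. -/
noncomputable def logTail (r : ℝ) (L : ℝ → ℝ) (γ x : ℝ) : ℝ :=
  x ^ (-r) * (Real.log x) ^ γ * L (Real.log x)

theorem one_lt_log_of_exp_one_lt {x : ℝ} (hx : Real.exp 1 < x) : 1 < Real.log x :=
  (Real.lt_log_iff_exp_lt ((Real.exp_pos 1).trans hx)).2 hx

theorem logTail_pos {r : ℝ} {L : ℝ → ℝ} (hLpos : ∀ y : ℝ, 1 < y → 0 < L y) (γ : ℝ) {x : ℝ}
    (hx : Real.exp 1 < x) : 0 < logTail r L γ x := by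
  have hx0 : 0 < x := (Real.exp_pos 1).trans hx
  have hl := one_lt_log_of_exp_one_lt hx
  have := hLpos _ hl
  have : 0 < Real.log x := by linarith
  unfold logTail
  positivity

/-- `logTail` is regularly varying with index `-r`. -/
theorem tendsto_logTail_mul_div {r : ℝ} {L : ℝ → ℝ} (hLpos : ∀ y : ℝ, 1 < y → 0 < L y)
    (hLcont : ContinuousOn L (Set.Ioi 1)) (hLslow : SlowlyVarying L) (γ : ℝ) {c : ℝ}
    (hc : 0 < c) :
    Tendsto (fun x => logTail r L γ (c * x) / logTail r L γ x) atTop (𝓝 (c ^ (-r))) := by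
  have h1 := (hLslow.tendsto_add_div hLpos hLcont (Real.log c)).comp Real.tendsto_log_atTop
  have h2 : Tendsto (fun y : ℝ => (1 + Real.log c / y) ^ γ) atTop (𝓝 1) := by
    have : Tendsto (fun y : ℝ => 1 + Real.log c / y) atTop (𝓝 (1 + 0)) :=
      (tendsto_const_nhds.div_atTop tendsto_id).const_add 1
    rw [add_zero] at this
    simpa using this.rpow_const (p := γ) (Or.inl one_ne_zero)
  have h3 := ((h2.comp Real.tendsto_log_atTop).mul h1).const_mul (c ^ (-r))
  rw [one_mul, mul_one] at h3
  refine h3.congr' ?_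
  filter_upwards [eventually_gt_atTop (Real.exp 1), eventually_gt_atTop (Real.exp 1 / c)]
    with x hx hcx
  rw [div_lt_iff₀ hc, mul_comm] at hcx
  have hx0 : 0 < x := (Real.exp_pos 1).trans hx
  have hl := one_lt_log_of_exp_one_lt hx
  have hlc := one_lt_log_of_exp_one_lt hcx
  have hl0 : 0 < Real.log x := by linarith
  have e1 : Real.log (c * x) = Real.log x + Real.log c := by
    rw [Real.log_mul hc.ne' hx0.ne', add_comm]
  have e2 : Real.log (c * x) = Real.log x * (1 + Real.log c / Real.log x) := by
    rw [e1]; field_simp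
  have p1 : 0 < 1 + Real.log c / Real.log x := by
    by_contra hcon
    have := mul_nonpos_of_nonneg_of_nonpos hl0.le (not_lt.1 hcon)
    rw [← e2] at this
    linarith
  have e3 : Real.log (c * x) ^ γ = Real.log x ^ γ * (1 + Real.log c / Real.log x) ^ γ := by
    rw [e2, Real.mul_rpow hl0.le p1.le]
  have q1 := hLpos _ hl
  have q2 : 0 < Real.log x ^ γ := by positivity
  have q3 : 0 < x ^ (-r) := by positivity
  simp only [Function.comp, logTail]
  rw [e3, Real.mul_rpow hc.le hx0.le, e1]
  field_simp

theorem continuousAt_logTail_uncurry (r : ℝ) {L : ℝ → ℝ} (hLcont : ContinuousOn L (Set.Ioi 1))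
    (γ : ℝ) {x : ℝ} (hx : Real.exp 1 < x) :
    ContinuousAt (fun p : ℝ × ℝ => logTail r L p.1 p.2) (γ, x) := by
  have hx0 : 0 < x := (Real.exp_pos 1).trans hx
  have hl := one_lt_log_of_exp_one_lt hx
  have hlog : ContinuousAt (fun p : ℝ × ℝ => Real.log p.2) (γ, x) :=
    continuousAt_snd.log hx0.ne'
  unfold logTail
  refine ((continuousAt_snd.rpow_const (Or.inl hx0.ne')).mul
    (hlog.rpow continuousAt_fst (Or.inl ?_))).mul ?_
  · simpa using (by linarith : Real.log x > 0).ne'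
  · exact ContinuousAt.comp (f := fun p : ℝ × ℝ => Real.log p.2)
      (hLcont.continuousAt (Ioi_mem_nhds hl)) hlog

/-- A regularly varying truncated second moment is controlled by the tail: abstract form. -/
theorem eventually_le_mul_of_doubling {g T : ℝ → ℝ} {q : ℝ} (hq0 : 0 < q) (hq1 : q < 1)
    (hT : Antitone T) (hTpos : ∀ x, 0 < T x) (hg1 : ∀ x, g x ≤ 1)
    (hrec : ∀ x, 0 < x → g (2 * x) ≤ g x / 4 + T x)
    (hdoub : ∀ᶠ x in atTop, T x ≤ 4 * q * T (2 * x)) :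
    ∀ᶠ x in atTop, g x ≤ (4 / (1 - q) + 1) * T x := by
  obtain ⟨X, hX⟩ := eventually_atTop.1 hdoub
  set X₀ := max X 1
  have hX₀ : 0 < X₀ := lt_of_lt_of_le one_pos (le_max_right _ _)
  set M := 1 / T (2 * X₀)
  have hM : 0 < M := one_div_pos.2 (hTpos _)
  -- The ratio `g / T` satisfies `ρ(2x) ≤ q ρ(x) + 4q`, and `D` dominates the fixed point `4q / (1 -
  -- q)`. The starting value `M` depends on `T`, but its contribution `q ^ k * M` falls below `1`
  -- after enough doublings; this is the `+ 1` in the constant, which thus depends on `q` only.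
  set D := 4 / (1 - q)
  have h1q : 0 < 1 - q := by linarith
  have hD : D * (1 - q) = 4 := div_mul_cancel₀ _ h1q.ne'
  have hDpos : 0 < D := by positivity
  have key : ∀ k : ℕ, ∀ x, 2 ^ k * X₀ ≤ x → x ≤ 2 ^ (k + 1) * X₀ →
      g x ≤ (q ^ k * M + D) * T x := by
    intro k
    induction k with
    | zero =>
      intro x h1 h2
      have : T (2 * X₀) ≤ T x := hT (by simpa using h2)
      have h3 : 1 ≤ M * T x := by
        rw [show M * T x = T x / T (2 * X₀) by simp only [M]; ring, one_le_div (hTpos _)]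
        exact this
      have h4 := hg1 x
      have h5 := mul_pos hDpos (hTpos x)
      rw [pow_zero, one_mul, add_mul]
      linarith
    | succ k ih =>
      intro x h1 h2
      have h3 := ih (x / 2) (by rw [pow_succ] at h1; linarith) (by rw [pow_succ] at h2; linarith)
      have hge : X₀ ≤ x / 2 := by
        have : (1 : ℝ) ≤ 2 ^ k := one_le_pow₀ (by norm_num)
        rw [pow_succ] at h1
        nlinarith
      have h4 := hrec (x / 2) (by linarith)
      have h5 := hX (x / 2) ((le_max_left _ _).trans hge)
      rw [show 2 * (x / 2) = x by ring] at h4 h5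
      have hA : 0 ≤ (q ^ k * M + D) / 4 + 1 := by positivity
      calc g x ≤ ((q ^ k * M + D) / 4 + 1) * T (x / 2) := by linarith
        _ ≤ ((q ^ k * M + D) / 4 + 1) * (4 * q * T x) := by gcongr
        _ = (q ^ (k + 1) * M + (D * q + 4 * q)) * T x := by ring
        _ ≤ _ := by
            gcongr
            · exact (hTpos x).le
            · nlinarith
  obtain ⟨k₀, hk₀⟩ := ((tendsto_pow_atTop_nhds_zero_of_lt_one hq0.le hq1).mul_const M).eventually
    (Iic_mem_nhds (by rw [zero_mul]; exact one_pos)) |>.exists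
  filter_upwards [eventually_ge_atTop (2 ^ k₀ * X₀)] with x hx
  have hx1 : 1 ≤ x / X₀ := by
    rw [one_le_div hX₀]
    have : (1 : ℝ) ≤ 2 ^ k₀ := one_le_pow₀ (by norm_num)
    nlinarith
  obtain ⟨k, hk1, hk2⟩ := exists_nat_pow_near hx1 (one_lt_two : (1 : ℝ) < 2)
  rw [le_div_iff₀ hX₀] at hk1
  rw [div_lt_iff₀ hX₀] at hk2
  have hkk : k₀ ≤ k := by
    by_contra hcon
    have : (2 : ℝ) ^ (k + 1) ≤ 2 ^ k₀ := pow_le_pow_right₀ (by norm_num) (by omega)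
    nlinarith
  refine (key k x hk1 hk2.le).trans ?_
  have hqk : q ^ k * M ≤ 1 :=
    (mul_le_mul_of_nonneg_right (pow_le_pow_of_le_one hq0.le hq1.le hkk) hM.le).trans hk₀
  exact mul_le_mul_of_nonneg_right (by linarith) (hTpos x).le

/-! ### Characteristic functions, truncated moments and tails of normed sums. -/

section Law

variable {Ω : Type*} [MeasurableSpace Ω] {P : Measure Ω} {ξ : Ω → ℝ}

theorem ProbabilityTheory.IdentDistrib.tailFn_eq {η : Ω → ℝ} (h : IdentDistrib η ξ P P) (x : ℝ) :
    tailFn P η x = tailFn P ξ x := by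
  have hs : MeasurableSet {y : ℝ | x ≤ |y|} := measurableSet_le measurable_const (by fun_prop)
  exact congrArg ENNReal.toReal (h.measure_mem_eq hs)

theorem charFun_eq_one_sub_psi (hξ : AEMeasurable ξ P)
    (hsymm : IdentDistrib ξ (fun ω => -ξ ω) P P) (t : ℝ) :
    charFun (P.map ξ) t = ((1 - psi P ξ t : ℝ) : ℂ) := by
  have h1 : charFun (P.map ξ) (-t) = charFun (P.map ξ) t := by
    conv_rhs => rw [hsymm.map_eq]
    have : P.map (fun ω => -ξ ω) = (P.map ξ).map (fun y => (-1 : ℝ) * y) := by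
      rw [AEMeasurable.map_map_of_aemeasurable (by fun_prop) hξ]
      congr 1; ext; simp
    rw [this, charFun_map_mul]
    simp
  rw [charFun_neg] at h1
  have h2 := Complex.conj_eq_iff_real.1 h1
  obtain ⟨a, ha⟩ := h2
  simp [psi, ha]

variable {X : ℕ → Ω → ℝ} {b : ℕ → ℝ}

theorem charFun_normedSum (hX : ∀ k, IdentDistrib (X k) ξ P P) (hind : iIndepFun X P)
    (n : ℕ) (t : ℝ) :
    charFun (P.map (normedSum X b n)) t = charFun (P.map ξ) ((b n)⁻¹ * t) ^ n := by
  have hm : ∀ k, AEMeasurable (X k) P := fun k => (hX k).aemeasurable_fst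
  have h1 : P.map (normedSum X b n) =
      (P.map (∑ k ∈ Finset.range n, X k)).map (fun y => (b n)⁻¹ * y) := by
    rw [AEMeasurable.map_map_of_aemeasurable (by fun_prop)
      (Finset.aemeasurable_sum _ fun k _ => hm k)]
    congr 1; ext; simp [normedSum]
  rw [h1, charFun_map_mul]
  have h2 := (hind.precomp (Subtype.val_injective (p := (· ∈ Finset.range n)))
    ).charFun_map_finsetSum_eq_prod (s := Finset.range n) (X := X) fun k _ => hm k
  rw [h2]
  simp [(hX _).map_eq]

variable [IsProbabilityMeasure P]

theorem tailFn_antitone (P : Measure Ω) [IsProbabilityMeasure P] (ξ : Ω → ℝ) :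
    Antitone (tailFn P ξ) := fun _ _ h =>
  measureReal_mono fun _ hω => h.trans hω

theorem tailFn_nonneg (P : Measure Ω) (ξ : Ω → ℝ) (x : ℝ) : 0 ≤ tailFn P ξ x :=
  measureReal_nonneg

theorem tailFn_le_one (P : Measure Ω) [IsProbabilityMeasure P] (ξ : Ω → ℝ) (x : ℝ) :
    tailFn P ξ x ≤ 1 := measureReal_le_one

theorem integrable_cos_mul (hξ : AEMeasurable ξ P) (t : ℝ) :
    Integrable (fun ω => Real.cos (t * ξ ω)) P :=
  Integrable.of_bound (by fun_prop) 1 (ae_of_all _ fun ω => by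
    simpa using Real.abs_cos_le_one _)

theorem integrable_one_sub_cos (hξ : AEMeasurable ξ P) (t : ℝ) :
    Integrable (fun ω => 1 - Real.cos (t * ξ ω)) P :=
  (integrable_const 1).sub (integrable_cos_mul hξ t)

theorem psi_eq_integral (hξ : AEMeasurable ξ P) (t : ℝ) :
    psi P ξ t = ∫ ω, (1 - Real.cos (t * ξ ω)) ∂P := by
  have h1 : charFun (P.map ξ) t = ∫ ω, Complex.exp (t * ξ ω * Complex.I) ∂P := by
    rw [charFun_apply_real, integral_map hξ (by fun_prop)]
  have hint : Integrable (fun ω => Complex.exp (t * ξ ω * Complex.I)) P := by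
    refine Integrable.of_bound (by fun_prop) 1 (ae_of_all _ fun ω => ?_)
    rw [← Complex.ofReal_mul, Complex.norm_exp_ofReal_mul_I]
  rw [psi, h1, integral_sub (integrable_const 1) (integrable_cos_mul hξ t)]
  congr 1
  · simp
  · have := Complex.reCLM.integral_comp_comm hint
    simp only [Complex.reCLM_apply] at this
    rw [← this]
    congr 1
    ext ω
    rw [← Complex.ofReal_mul, Complex.exp_ofReal_mul_I_re]

theorem psi_nonneg (hξ : AEMeasurable ξ P) (t : ℝ) : 0 ≤ psi P ξ t := by
  rw [psi_eq_integral hξ]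
  exact integral_nonneg fun ω => sub_nonneg.2 (Real.cos_le_one _)

theorem psi_zero (hξ : AEMeasurable ξ P) : psi P ξ 0 = 0 := by
  simp [psi_eq_integral hξ]

theorem continuous_psi (hξ : AEMeasurable ξ P) : Continuous (psi P ξ) := by
  have := Measure.isProbabilityMeasure_map hξ
  unfold psi
  fun_prop

theorem psi_neg (hξ : AEMeasurable ξ P) (t : ℝ) : psi P ξ (-t) = psi P ξ t := by
  simp [psi_eq_integral hξ]

/-- The tail mass of an interval on which `1 - cos (s x) ≥ ε` bounds `ψ` from below. -/
theorem mul_tailFn_sub_le_psi (hξ : AEMeasurable ξ P) {s ε x₁ x₂ : ℝ} (hε : 0 ≤ ε)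
    (h : ∀ x ∈ Set.Icc x₁ x₂, ε ≤ 1 - Real.cos (s * x)) :
    ε * (tailFn P ξ x₁ - tailFn P ξ x₂) ≤ psi P ξ s := by
  have hmeas : tailFn P ξ x₁ - tailFn P ξ x₂ ≤
      P.real ({ω | x₁ ≤ |ξ ω|} \ {ω | x₂ ≤ |ξ ω|}) :=
    le_measureReal_sdiff (measure_ne_top _ _)
  rw [psi_eq_integral hξ]
  have hsub2 : {ω | x₁ ≤ |ξ ω|} \ {ω | x₂ ≤ |ξ ω|} ⊆ {ω | ε ≤ 1 - Real.cos (s * ξ ω)} := by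
    rintro ω ⟨h1, h2⟩
    have := h |ξ ω| ⟨h1, (not_le.1 h2).le⟩
    rcases abs_cases (ξ ω) with ⟨e, -⟩ | ⟨e, -⟩
    · rwa [e] at this
    · rwa [e, mul_neg, Real.cos_neg] at this
  calc _ ≤ ε * P.real {ω | ε ≤ 1 - Real.cos (s * ξ ω)} := by
        gcongr
        exact hmeas.trans (measureReal_mono hsub2 (measure_ne_top _ _))
    _ ≤ _ := mul_meas_ge_le_integral_of_nonneg
        (ae_of_all _ fun ω => sub_nonneg.2 (Real.cos_le_one _)) (integrable_one_sub_cos hξ s) ε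

/-- The truncated second moment `E min(1, (ξ/X)²)`. -/
noncomputable def truncMoment (P : Measure Ω) (ξ : Ω → ℝ) (X : ℝ) : ℝ :=
  ∫ ω, min 1 ((ξ ω / X) ^ 2) ∂P

theorem integrable_truncMoment (hξ : AEMeasurable ξ P) (X : ℝ) :
    Integrable (fun ω => min 1 ((ξ ω / X) ^ 2)) P := by
  refine Integrable.of_bound (by fun_prop) 1 (ae_of_all _ fun ω => ?_)
  rw [Real.norm_of_nonneg (by positivity)]
  exact min_le_left _ _

theorem truncMoment_le_one (hξ : AEMeasurable ξ P) (X : ℝ) : truncMoment P ξ X ≤ 1 := by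
  calc truncMoment P ξ X ≤ ∫ _, (1 : ℝ) ∂P :=
        integral_mono (integrable_truncMoment hξ X) (integrable_const 1) fun ω => min_le_left _ _
    _ = 1 := by simp

/-- Where `|ξ| < X`, doubling the level divides the square by four; elsewhere the integrand is at
most one, which costs the tail. -/
theorem truncMoment_two_mul_le (hξ : AEMeasurable ξ P) {X : ℝ} (hX : 0 < X) :
    truncMoment P ξ (2 * X) ≤ truncMoment P ξ X / 4 + tailFn P ξ X := by
  have m : NullMeasurableSet {ω | X ≤ |ξ ω|} P :=
    nullMeasurableSet_le aemeasurable_const (by fun_prop)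
  have hind : Integrable ({ω | X ≤ |ξ ω|}.indicator fun _ => (1 : ℝ)) P :=
    (integrable_const 1).indicator₀ m
  have e : tailFn P ξ X = ∫ ω, {ω | X ≤ |ξ ω|}.indicator (fun _ => (1 : ℝ)) ω ∂P := by
    rw [integral_indicator₀ m]
    simp [tailFn]
  rw [e, truncMoment, truncMoment, ← integral_div,
    ← integral_add ((integrable_truncMoment hξ X).div_const 4) hind]
  refine integral_mono (integrable_truncMoment hξ _)
    (((integrable_truncMoment hξ X).div_const 4).add hind) fun ω => ?_
  by_cases h : X ≤ |ξ ω|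
  · have : (0 : ℝ) ≤ min 1 ((ξ ω / X) ^ 2) := by positivity
    have h2 : min 1 ((ξ ω / (2 * X)) ^ 2) ≤ (1 : ℝ) := min_le_left _ _
    simp only [Set.indicator, Set.mem_ofPred_eq, h, if_true]
    linarith
  · have h1 : (ξ ω / X) ^ 2 ≤ 1 := by
      rw [sq_le_one_iff_abs_le_one, abs_div, abs_of_pos hX, div_le_one hX]
      exact (not_le.1 h).le
    simp only [Set.indicator, Set.mem_ofPred_eq, h, if_false, add_zero]
    rw [min_eq_right h1]
    refine (min_le_right _ _).trans (le_of_eq ?_)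
    field_simp
    norm_num

theorem one_sub_cos_le_two_mul_min (u : ℝ) : 1 - Real.cos u ≤ 2 * min 1 (u ^ 2) := by
  have h1 := Real.one_sub_sq_div_two_le_cos (x := u)
  have h2 := Real.neg_one_le_cos u
  rcases min_cases 1 (u ^ 2) with ⟨e, -⟩ | ⟨e, -⟩ <;> rw [e] <;> nlinarith [sq_nonneg u]

theorem psi_le_two_mul_truncMoment (hξ : AEMeasurable ξ P) {t X : ℝ} (hX : 0 < X)
    (ht : |t| ≤ 1 / X) : psi P ξ t ≤ 2 * truncMoment P ξ X := by
  rw [psi_eq_integral hξ, truncMoment, ← integral_const_mul]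
  refine integral_mono (integrable_one_sub_cos hξ t)
    ((integrable_truncMoment hξ X).const_mul 2) fun ω => ?_
  refine (one_sub_cos_le_two_mul_min _).trans ?_
  have : (t * ξ ω) ^ 2 ≤ (ξ ω / X) ^ 2 := by
    rw [sq_le_sq, abs_mul, abs_div, abs_of_pos hX, div_eq_mul_one_div, mul_comm]
    gcongr
  gcongr

theorem norm_one_sub_pow_le {z : ℂ} (hz : ‖z‖ ≤ 1) (n : ℕ) : ‖1 - z ^ n‖ ≤ n * ‖1 - z‖ := by
  rw [← mul_neg_geom_sum, norm_mul, mul_comm]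
  gcongr
  refine (norm_sum_le _ _).trans ?_
  calc ∑ i ∈ Finset.range n, ‖z ^ i‖ ≤ ∑ i ∈ Finset.range n, (1 : ℝ) :=
        Finset.sum_le_sum fun i _ => by rw [norm_pow]; exact pow_le_one₀ (norm_nonneg _) hz
    _ = n := by simp

/-- By symmetry `1 - φ = ψ` is real and nonnegative, so the integrand `|1 - φ(t / b(n)) ^ n|` in the
truncation inequality is at most `n ψ(t / b(n))`. -/
theorem tailFn_normedSum_le_integral (hsymm : IdentDistrib ξ (fun ω => -ξ ω) P P)
    (hX : ∀ k, IdentDistrib (X k) ξ P P) (hind : iIndepFun X P) (n : ℕ) {x M : ℝ} (hx : 0 < x)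
    (hM : ∀ t : ℝ, |t| ≤ 4 / x → n * psi P ξ ((b n)⁻¹ * t) ≤ M) :
    tailFn P (normedSum X b n) x ≤ 2 * M := by
  have hξ : AEMeasurable ξ P := hsymm.aemeasurable_fst
  have hm : ∀ k, AEMeasurable (X k) P := fun k => (hX k).aemeasurable_fst
  have hS : AEMeasurable (normedSum X b n) P := by
    unfold normedSum
    fun_prop
  have := Measure.isProbabilityMeasure_map hS
  have := Measure.isProbabilityMeasure_map hξ
  -- The truncation inequality concerns a strict tail, so it is applied at `x / 2`; this yields the
  -- range `|t| ≤ 4 / x`.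
  have h1 := measureReal_abs_gt_le_integral_charFun (μ := P.map (normedSum X b n))
    (half_pos hx)
  have h2 : tailFn P (normedSum X b n) x ≤ (P.map (normedSum X b n)).real {y | x / 2 < |y|} := by
    rw [map_measureReal_apply_of_aemeasurable hS (measurableSet_lt measurable_const (by fun_prop))]
    exact measureReal_mono fun ω hω => lt_of_lt_of_le (half_lt_self hx) hω
  refine h2.trans (h1.trans ?_)
  have e : 2 * (x / 2)⁻¹ = 4 / x := by field_simp; norm_num
  have h3 : ‖∫ t in (-2 * (x / 2)⁻¹)..(2 * (x / 2)⁻¹), 1 - charFun (P.map (normedSum X b n)) t‖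
      ≤ M * |2 * (x / 2)⁻¹ - (-2 * (x / 2)⁻¹)| := by
    refine intervalIntegral.norm_integral_le_of_norm_le_const fun t ht => ?_
    rw [neg_mul, e, Set.uIoc_of_le (by linarith [(show 0 < 4 / x by positivity)])] at ht
    have ht' : |t| ≤ 4 / x := abs_le.2 ⟨ht.1.le, ht.2⟩
    rw [charFun_normedSum hX hind]
    refine (norm_one_sub_pow_le (norm_charFun_le_one _) n).trans ?_
    rw [charFun_eq_one_sub_psi hξ hsymm, ← Complex.ofReal_one, ← Complex.ofReal_sub,
      Complex.norm_real, sub_sub_cancel, Real.norm_of_nonneg (psi_nonneg hξ _)]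
    exact hM t ht'
  have e2 : |2 * (x / 2)⁻¹ - (-2 * (x / 2)⁻¹)| = 8 / x := by
    rw [neg_mul, e, abs_of_pos]
    · ring
    · have : 0 < 4 / x := by positivity
      linarith
  rw [e2] at h3
  calc _ ≤ 2⁻¹ * (x / 2) * (M * (8 / x)) := by gcongr
    _ = 2 * M := by field_simp; ring

/-- The trivial union bound for the tail of a normed sum. -/
theorem tailFn_normedSum_le_mul (hX : ∀ k, IdentDistrib (X k) ξ P P) {n : ℕ} (hn : 1 ≤ n)
    (hb : 0 < b n) (x : ℝ) :
    tailFn P (normedSum X b n) x ≤ n * tailFn P ξ (x * b n / n) := by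
  have hn0 : (0 : ℝ) < n := by exact_mod_cast hn
  have hsub : {ω | x ≤ |normedSum X b n ω|} ⊆
      ⋃ k ∈ Finset.range n, {ω | x * b n / n ≤ |X k ω|} := by
    intro ω hω
    simp only [Set.mem_ofPred_eq, normedSum, abs_mul, abs_inv, abs_of_pos hb] at hω
    rw [inv_mul_eq_div, le_div_iff₀ hb] at hω
    simp only [Set.mem_iUnion, Set.mem_ofPred_eq, exists_prop]
    by_contra! hcon
    have h1 : ∑ k ∈ Finset.range n, |X k ω| < ∑ k ∈ Finset.range n, x * b n / n :=
      Finset.sum_lt_sum_of_nonempty (Finset.nonempty_range_iff.2 (by omega)) hcon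
    have h2 := Finset.abs_sum_le_sum_abs (fun k => X k ω) (Finset.range n)
    rw [Finset.sum_const, Finset.card_range, nsmul_eq_mul, mul_div_cancel₀ _ hn0.ne'] at h1
    linarith
  calc _ ≤ P.real (⋃ k ∈ Finset.range n, {ω | x * b n / n ≤ |X k ω|}) := measureReal_mono hsub (measure_ne_top _ _)
    _ ≤ ∑ k ∈ Finset.range n, P.real {ω | x * b n / n ≤ |X k ω|} :=
        measureReal_biUnion_finset_le _ _
    _ = ∑ k ∈ Finset.range n, tailFn P ξ (x * b n / n) :=
        Finset.sum_congr rfl fun k _ => (hX k).tailFn_eq _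
    _ = _ := by simp

end Law

/-! ### Lower bounds for `ψ` uniform in the exponent and the frequency. -/

section Uniform

variable {r : ℝ} {L : ℝ → ℝ}

theorem eventually_cos_mul_ne_one {s : ℝ} (hs : 0 < s) (x : ℝ) :
    ∀ᶠ y in 𝓝[>] x, Real.cos (s * y) ≠ 1 := by
  have hπ : 0 < 2 * Real.pi := by positivity
  set n₀ := ⌊s * x / (2 * Real.pi)⌋
  have hlt : x < (n₀ + 1) * (2 * Real.pi) / s := by
    rw [lt_div_iff₀ hs, ← div_lt_iff₀ hπ, mul_comm]
    exact Int.lt_floor_add_one _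
  filter_upwards [Ioo_mem_nhdsGT hlt] with y hy hcos
  obtain ⟨n, hn⟩ := (Real.cos_eq_one_iff _).1 hcos
  have h1 : n₀ < n := by
    refine Int.floor_lt.2 ?_
    rw [div_lt_iff₀ hπ, hn]
    exact mul_lt_mul_of_pos_left hy.1 hs
  have h2 : (n : ℝ) < n₀ + 1 := by
    have := hy.2
    rw [lt_div_iff₀ hs, mul_comm, ← hn] at this
    exact lt_of_mul_lt_mul_right this hπ.le
  have h3 : n < n₀ + 1 := by exact_mod_cast h2
  omega

theorem continuousAt_logTail (r : ℝ) (hLcont : ContinuousOn L (Set.Ioi 1)) (γ : ℝ) {x : ℝ}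
    (hx : Real.exp 1 < x) : ContinuousAt (logTail r L γ) x :=
  ContinuousAt.comp (f := fun x : ℝ => (γ, x)) (continuousAt_logTail_uncurry r hLcont γ hx)
    (by fun_prop)

/-- On such an interval the tail loses mass where `1 - cos (s x)` is positive, which makes `ψ(s)`
positive. No law is involved, so the drop is extracted from continuity and regular variation alone,
without monotonicity. -/
theorem exists_logTail_lt_of_cos_ne_one (hr : 0 < r) (hLpos : ∀ y : ℝ, 1 < y → 0 < L y)
    (hLcont : ContinuousOn L (Set.Ioi 1)) (hLslow : SlowlyVarying L) (γ : ℝ) {s : ℝ}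
    (hs : 0 < s) :
    ∃ x₁ x₂ : ℝ, Real.exp 1 < x₁ ∧ x₁ < x₂ ∧ (∀ x ∈ Set.Icc x₁ x₂, Real.cos (s * x) ≠ 1) ∧
      logTail r L γ x₂ < logTail r L γ x₁ := by
  set τ := logTail r L γ with hτ
  have hcont : ∀ x, Real.exp 1 < x → ContinuousAt τ x := fun x hx =>
    continuousAt_logTail r hLcont γ hx
  obtain ⟨a, ha, hab⟩ : ∃ a, Real.exp 1 < a ∧ τ (2 * a) < τ a := by
    have h1 := (tendsto_logTail_mul_div hLpos hLcont hLslow (r := r) γ two_pos).eventually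
      (Iio_mem_nhds (Real.rpow_lt_one_of_one_lt_of_neg one_lt_two (neg_lt_zero.2 hr)))
    obtain ⟨a, h, ha⟩ := (h1.and (eventually_gt_atTop (Real.exp 1))).exists
    exact ⟨a, ha, (div_lt_one (logTail_pos hLpos γ ha)).1 h⟩
  have ha0 : 0 < a := (Real.exp_pos 1).trans ha
  have hcontOn : ContinuousOn τ (Set.Icc a (2 * a)) := fun x hx =>
    (hcont x (ha.trans_le hx.1)).continuousWithinAt
  have hclosed : IsClosed ({x | τ a ≤ τ x} ∩ Set.Icc a (2 * a)) := by
    have := hcontOn.preimage_isClosed_of_isClosed isClosed_Icc (isClosed_Ici (a := τ a))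
    rwa [Set.inter_comm] at this
  -- If `τ ≥ τ a` always persisted a little to the right, it would persist up to `2 * a`. So it
  -- fails immediately to the right of some `x`, where the zeros of `1 - cos (s ·)` can be avoided
  -- because they are isolated.
  have hnot : ¬ ∀ x ∈ {x | τ a ≤ τ x} ∩ Set.Ico a (2 * a), {x | τ a ≤ τ x} ∈ 𝓝[>] x := by
    intro h
    have := hclosed.Icc_subset_of_forall_mem_nhdsWithin (by simp) h
    exact absurd (this (Set.right_mem_Icc.2 (by linarith))) (not_le.2 hab)
  push Not at hnot
  obtain ⟨x, ⟨hx1, hx2⟩, hx3⟩ := hnot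
  have hex : Real.exp 1 < x := ha.trans_le hx2.1
  obtain ⟨z, hz, hzsub⟩ := mem_nhdsGT_iff_exists_Ioo_subset.1 (eventually_cos_mul_ne_one hs x)
  have hfreq : ∃ᶠ y in 𝓝[>] x, τ y < τ a := by
    intro h
    exact hx3 (by filter_upwards [h] with y hy using not_lt.1 hy)
  obtain ⟨x₂, hx₂, hx₂'⟩ := (hfreq.and_eventually (Ioo_mem_nhdsGT hz)).exists
  have hev : ∀ᶠ y in 𝓝[>] x, τ x₂ < τ y :=
    ((hcont x hex).eventually (Ioi_mem_nhds (hx₂.trans_le hx1))).filter_mono nhdsWithin_le_nhds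
  obtain ⟨x₁, h1, h1'⟩ := (hev.and (Ioo_mem_nhdsGT hx₂'.1)).exists
  exact ⟨x₁, x₂, hex.trans h1'.1, h1'.2, fun y hy =>
    hzsub ⟨h1'.1.trans_le hy.1, hy.2.trans_lt hx₂'.2⟩, h1⟩

/-- A lower bound for `ψ`, uniform over compact sets of exponents and of frequencies, that is
expressed by the tail alone. -/
theorem exists_uniform_mul_logTail_sub (hr : 0 < r) (hLpos : ∀ y : ℝ, 1 < y → 0 < L y)
    (hLcont : ContinuousOn L (Set.Ioi 1)) (hLslow : SlowlyVarying L) {K : Set (ℝ × ℝ)}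
    (hK : IsCompact K) (hKpos : ∀ p ∈ K, 0 < p.2) :
    ∃ κ : ℝ, 0 < κ ∧ ∀ p ∈ K, ∃ x₁ x₂ ε : ℝ, 0 ≤ ε ∧ Real.exp 1 < x₁ ∧ x₁ < x₂ ∧
      (∀ x ∈ Set.Icc x₁ x₂, ε ≤ 1 - Real.cos (p.2 * x)) ∧
      κ ≤ ε * (logTail r L p.1 x₁ - logTail r L p.1 x₂) := by
  refine hK.induction_on (p := fun U : Set (ℝ × ℝ) =>
    ∃ κ : ℝ, 0 < κ ∧ ∀ p ∈ U, ∃ x₁ x₂ ε : ℝ, 0 ≤ ε ∧ Real.exp 1 < x₁ ∧ x₁ < x₂ ∧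
      (∀ x ∈ Set.Icc x₁ x₂, ε ≤ 1 - Real.cos (p.2 * x)) ∧
      κ ≤ ε * (logTail r L p.1 x₁ - logTail r L p.1 x₂)) ⟨1, one_pos, by simp⟩ ?_ ?_ ?_
  · rintro U V hUV ⟨κ, hκ, h⟩
    exact ⟨κ, hκ, fun p hp => h p (hUV hp)⟩
  · rintro U V ⟨κ, hκ, h⟩ ⟨κ', hκ', h'⟩
    refine ⟨min κ κ', lt_min hκ hκ', ?_⟩
    rintro p (hp | hp)
    · obtain ⟨x₁, x₂, ε, h1, h2, h3, h4, h5⟩ := h p hp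
      exact ⟨x₁, x₂, ε, h1, h2, h3, h4, (min_le_left _ _).trans h5⟩
    · obtain ⟨x₁, x₂, ε, h1, h2, h3, h4, h5⟩ := h' p hp
      exact ⟨x₁, x₂, ε, h1, h2, h3, h4, (min_le_right _ _).trans h5⟩
  · rintro ⟨γ, s⟩ hp
    obtain ⟨x₁, x₂, h1, h2, h3, h4⟩ :=
      exists_logTail_lt_of_cos_ne_one hr hLpos hLcont hLslow γ (hKpos _ hp)
    obtain ⟨x₀, hx₀, hmin⟩ := isCompact_Icc.exists_isMinOn (Set.nonempty_Icc.2 h2.le)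
      (f := fun x => 1 - Real.cos (s * x)) (by fun_prop)
    -- Half of each gap at `(γ, s)` is given away, so that the same `x₁`, `x₂` serve for all nearby
    -- exponents and frequencies.
    set ε := (1 - Real.cos (s * x₀)) / 2
    have hε : 0 < ε := half_pos (sub_pos.2 (lt_of_le_of_ne (Real.cos_le_one _) (h3 _ hx₀)))
    set δ := (logTail r L γ x₁ - logTail r L γ x₂) / 2
    have hδ : 0 < δ := half_pos (sub_pos.2 h4)
    have hx₂0 : 0 < x₂ := (Real.exp_pos 1).trans (h1.trans h2)
    have e1 : ∀ᶠ p : ℝ × ℝ in 𝓝 (γ, s), |p.2 - s| * x₂ < ε :=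
      (show ContinuousAt (fun p : ℝ × ℝ => |p.2 - s| * x₂) (γ, s) by fun_prop).eventually
        (Iio_mem_nhds (by simpa using hε))
    have ct : ∀ x, Real.exp 1 < x → ContinuousAt (fun p : ℝ × ℝ => logTail r L p.1 x) (γ, s) :=
      fun x hx => ContinuousAt.comp (f := fun p : ℝ × ℝ => (p.1, x)) (x := (γ, s))
        (g := fun p : ℝ × ℝ => logTail r L p.1 p.2)
        (continuousAt_logTail_uncurry r hLcont γ hx) (by fun_prop)
    have e2 : ∀ᶠ p : ℝ × ℝ in 𝓝 (γ, s), δ < logTail r L p.1 x₁ - logTail r L p.1 x₂ :=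
      ((ct x₁ h1).sub (ct x₂ (h1.trans h2))).eventually (Ioi_mem_nhds (half_lt_self (by linarith)))
    refine ⟨{p | |p.2 - s| * x₂ < ε ∧ δ < logTail r L p.1 x₁ - logTail r L p.1 x₂},
      mem_nhdsWithin_of_mem_nhds (e1.and e2), ε * δ, by positivity, ?_⟩
    rintro p ⟨hp1, hp2⟩
    refine ⟨x₁, x₂, ε, hε.le, h1, h2, fun x hx => ?_, by gcongr⟩
    have hx0 : 0 < x := (Real.exp_pos 1).trans (h1.trans_le hx.1)
    have q1 : 2 * ε ≤ 1 - Real.cos (s * x) := by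
      have := hmin hx
      simp only [Set.mem_ofPred_eq] at this
      simp only [ε]
      linarith
    have q2 : |Real.cos (p.2 * x) - Real.cos (s * x)| ≤ |p.2 * x - s * x| := by
      simpa [Real.dist_eq] using Real.lipschitzWith_cos.dist_le_mul (p.2 * x) (s * x)
    have q3 : |p.2 * x - s * x| ≤ |p.2 - s| * x₂ := by
      rw [← sub_mul, abs_mul, abs_of_pos hx0]
      exact mul_le_mul_of_nonneg_left hx.2 (abs_nonneg _)
    have := le_abs_self (Real.cos (p.2 * x) - Real.cos (s * x))
    linarith

end Uniform

/-! ### Comparison of `ψ` with the tail, and the admissible exponents. -/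

section Tail

variable {Ω : Type*} [MeasurableSpace Ω] {P : Measure Ω} {ξ : Ω → ℝ}
  {r γ : ℝ} {L : ℝ → ℝ}

theorem HasLogTail.tendsto_tailFn_mul_div (hLpos : ∀ y : ℝ, 1 < y → 0 < L y)
    (hLcont : ContinuousOn L (Set.Ioi 1)) (hLslow : SlowlyVarying L)
    (hT : HasLogTail P ξ r γ L) {c : ℝ} (hc : 0 < c) :
    Tendsto (fun x => tailFn P ξ (c * x) / tailFn P ξ x) atTop (𝓝 (c ^ (-r))) := by
  refine (tendsto_logTail_mul_div hLpos hLcont hLslow γ hc).congr' ?_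
  filter_upwards [eventually_gt_atTop (Real.exp 1), eventually_gt_atTop (Real.exp 1 / c)]
    with x hx hcx
  rw [div_lt_iff₀ hc, mul_comm] at hcx
  rw [hT _ hx, hT _ hcx]
  rfl

variable [IsProbabilityMeasure P]

theorem HasLogTail.tailFn_pos (hLpos : ∀ y : ℝ, 1 < y → 0 < L y) (hT : HasLogTail P ξ r γ L)
    (x : ℝ) : 0 < tailFn P ξ x := by
  have h : Real.exp 1 < max x (Real.exp 1 + 1) := lt_max_of_lt_right (by linarith)
  refine lt_of_lt_of_le ?_ (tailFn_antitone P ξ (le_max_left x (Real.exp 1 + 1)))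
  rw [hT _ h]
  exact logTail_pos hLpos γ h

theorem HasLogTail.eventually_tailFn_mul_le (hLpos : ∀ y : ℝ, 1 < y → 0 < L y)
    (hLcont : ContinuousOn L (Set.Ioi 1)) (hLslow : SlowlyVarying L)
    (hT : HasLogTail P ξ r γ L) {c A : ℝ} (hc : 0 < c) (hA : c ^ (-r) < A) :
    ∀ᶠ x in atTop, tailFn P ξ (c * x) ≤ A * tailFn P ξ x := by
  filter_upwards [(hT.tendsto_tailFn_mul_div hLpos hLcont hLslow hc).eventually (Iio_mem_nhds hA)]
    with x hx
  exact ((div_lt_iff₀ (hT.tailFn_pos hLpos x)).1 hx).le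

/-- The constant in the Karamata type bound for the truncated second moment. -/
noncomputable def karamataConst (r : ℝ) : ℝ := 4 / (1 - (2 ^ r + 4) / 8) + 1

theorem two_rpow_lt_four (hr2 : r < 2) : (2 : ℝ) ^ r < 4 := by
  have := Real.rpow_lt_rpow_of_exponent_lt one_lt_two hr2
  norm_num at this
  exact this

theorem karamataConst_pos (hr2 : r < 2) : 0 < karamataConst r := by
  have := two_rpow_lt_four hr2
  have : 0 < 1 - ((2 : ℝ) ^ r + 4) / 8 := by linarith
  unfold karamataConst
  positivity

/-- The ratio `T(x) / T(2x)` tends to `2 ^ r`, which is below the factor `4` gained by doubling the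
truncation level. The chosen `q` is the midpoint of `2 ^ r / 4` and `1`, so the constant involves
`r` only. -/
theorem HasLogTail.eventually_truncMoment_le (hξ : AEMeasurable ξ P) (hr2 : r < 2)
    (hLpos : ∀ y : ℝ, 1 < y → 0 < L y)
    (hLcont : ContinuousOn L (Set.Ioi 1)) (hLslow : SlowlyVarying L)
    (hT : HasLogTail P ξ r γ L) :
    ∀ᶠ x in atTop, truncMoment P ξ x ≤ karamataConst r * tailFn P ξ x := by
  have h4 := two_rpow_lt_four hr2
  have h0 : (0 : ℝ) < 2 ^ r := by positivity
  refine eventually_le_mul_of_doubling (q := (2 ^ r + 4) / 8) (by positivity) (by linarith)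
    (tailFn_antitone P ξ) (hT.tailFn_pos hLpos) (truncMoment_le_one hξ)
    (fun x hx => truncMoment_two_mul_le hξ hx) ?_
  have hlt : 1 / (4 * (((2 : ℝ) ^ r + 4) / 8)) < 2 ^ (-r) := by
    rw [Real.rpow_neg zero_le_two, ← one_div]
    exact one_div_lt_one_div_of_lt h0 (by linarith)
  filter_upwards [(hT.tendsto_tailFn_mul_div hLpos hLcont hLslow two_pos).eventually
    (Ioi_mem_nhds hlt)] with x hx
  change _ < _ at hx
  rw [div_lt_div_iff₀ (by positivity) (hT.tailFn_pos hLpos x)] at hx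
  linarith

/-- For `|ξ|` in `[x, 2x)` the phase `|ξ| / x` lies in `[1, 2]`, where `1 - cos` is at least `1 -
cos 1`; by regular variation this range carries a fixed proportion of `T(x)`. -/
theorem HasLogTail.eventually_le_psi (hξ : AEMeasurable ξ P) (hr0 : 0 < r)
    (hLpos : ∀ y : ℝ, 1 < y → 0 < L y)
    (hLcont : ContinuousOn L (Set.Ioi 1)) (hLslow : SlowlyVarying L)
    (hT : HasLogTail P ξ r γ L) :
    ∃ c : ℝ, 0 < c ∧ ∀ᶠ x in atTop, c * tailFn P ξ x ≤ psi P ξ (1 / x) := by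
  have h1 : (2 : ℝ) ^ (-r) < 1 := Real.rpow_lt_one_of_one_lt_of_neg one_lt_two (neg_lt_zero.2 hr0)
  set θ := ((2 : ℝ) ^ (-r) + 1) / 2
  have hcos : 0 < 1 - Real.cos 1 := sub_pos.2 (Real.cos_one_le.trans_lt (by norm_num))
  refine ⟨(1 - Real.cos 1) * (1 - θ), mul_pos hcos (by simp only [θ]; linarith), ?_⟩
  filter_upwards [hT.eventually_tailFn_mul_le hLpos hLcont hLslow two_pos
    (show (2 : ℝ) ^ (-r) < θ by simp only [θ]; linarith), eventually_gt_atTop 0] with x hx hx0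
  calc (1 - Real.cos 1) * (1 - θ) * tailFn P ξ x
      ≤ (1 - Real.cos 1) * (tailFn P ξ x - tailFn P ξ (2 * x)) := by
        rw [mul_assoc]
        gcongr
        linarith
    _ ≤ psi P ξ (1 / x) := by
        refine mul_tailFn_sub_le_psi hξ hcos.le fun y hy => ?_
        have l1 : 1 ≤ 1 / x * y := by
          rw [one_div_mul_eq_div, one_le_div hx0]; exact hy.1
        have l2 : 1 / x * y ≤ 2 := by
          rw [one_div_mul_eq_div, div_le_iff₀ hx0]; exact hy.2
        have := Real.cos_le_cos_of_nonneg_of_le_pi zero_le_one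
          (l2.trans Real.two_le_pi) l1
        linarith

theorem HasLogTail.eventually_psi_le (hξ : AEMeasurable ξ P) (hr2 : r < 2)
    (hLpos : ∀ y : ℝ, 1 < y → 0 < L y)
    (hLcont : ContinuousOn L (Set.Ioi 1)) (hLslow : SlowlyVarying L)
    (hT : HasLogTail P ξ r γ L) :
    ∀ᶠ x in atTop, psi P ξ (1 / x) ≤ 2 * karamataConst r * tailFn P ξ x := by
  filter_upwards [hT.eventually_truncMoment_le hξ hr2 hLpos hLcont hLslow,
    eventually_gt_atTop 0] with x hx hx0
  have := psi_le_two_mul_truncMoment hξ hx0 (t := 1 / x) (by rw [abs_of_pos (by positivity)])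
  linarith

/-- A slowly varying function times a negative power is not bounded away from zero. -/
theorem SlowlyVarying.exists_rpow_mul_lt (hLpos : ∀ y : ℝ, 1 < y → 0 < L y)
    (hLslow : SlowlyVarying L) (hγ : γ < 0) {c : ℝ} (hc : 0 < c) (Y : ℝ) :
    ∃ y, Y ≤ y ∧ y ^ γ * L y < c := by
  have hq1 : (2 : ℝ) ^ γ < 1 := Real.rpow_lt_one_of_one_lt_of_neg one_lt_two hγ
  have hq0 : (0 : ℝ) < 2 ^ γ := by positivity
  set q := ((2 : ℝ) ^ γ + 1) / 2
  have hev : ∀ᶠ y in atTop, (2 * y) ^ γ * L (2 * y) ≤ q * (y ^ γ * L y) := by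
    have h1 := (hLslow 2 two_pos).const_mul ((2 : ℝ) ^ γ)
    rw [mul_one] at h1
    filter_upwards [h1.eventually (Iio_mem_nhds (show (2 : ℝ) ^ γ < q by simp only [q]; linarith)),
      eventually_gt_atTop 1] with y hy hy1
    have hL := hLpos y hy1
    change _ < _ at hy
    rw [← mul_div_assoc, div_lt_iff₀ hL] at hy
    rw [Real.mul_rpow zero_le_two (by linarith)]
    have : 0 < y ^ γ := by positivity
    nlinarith
  obtain ⟨Z, hZ⟩ := eventually_atTop.1 hev
  set y₀ := max (max Y Z) 1
  have hy₀ : 1 ≤ y₀ := le_max_right _ _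
  have hge : ∀ k : ℕ, y₀ ≤ 2 ^ k * y₀ := fun k => by
    have : (1 : ℝ) ≤ 2 ^ k := one_le_pow₀ (by norm_num)
    nlinarith
  have hind : ∀ k : ℕ, (2 ^ k * y₀) ^ γ * L (2 ^ k * y₀) ≤ q ^ k * (y₀ ^ γ * L y₀) := by
    intro k
    induction k with
    | zero => simp
    | succ k ih =>
      have h1 := hZ (2 ^ k * y₀)
        (((le_max_right Y Z).trans (le_max_left _ _)).trans (hge k))
      rw [pow_succ', pow_succ', mul_assoc, mul_assoc]
      exact h1.trans (mul_le_mul_of_nonneg_left ih (by positivity))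
  have hlim := (tendsto_pow_atTop_nhds_zero_of_lt_one (r := q) (by positivity)
    (by simp only [q]; linarith)).mul_const (y₀ ^ γ * L y₀)
  rw [zero_mul] at hlim
  obtain ⟨k, hk⟩ := (hlim.eventually (Iio_mem_nhds hc)).exists
  exact ⟨2 ^ k * y₀, ((le_max_left Y Z).trans (le_max_left _ _)).trans (hge k),
    (hind k).trans_lt hk⟩

/-- Membership in `MD` excludes negative powers of the logarithm in the tail. -/
theorem ClassMD.exponent_nonneg (hξ : AEMeasurable ξ P) (hr0 : 0 < r) (hr2 : r < 2)
    (hLpos : ∀ y : ℝ, 1 < y → 0 < L y)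
    (hLcont : ContinuousOn L (Set.Ioi 1)) (hLslow : SlowlyVarying L)
    (hT : HasLogTail P ξ r γ L) (hMD : ClassMD P ξ) : 0 ≤ γ := by
  by_contra! hγ
  have hC := karamataConst_pos hr2
  set C := 2 * karamataConst r
  have hC0 : 0 < C := by positivity
  obtain ⟨c, hc, hlow⟩ := hT.eventually_le_psi hξ hr0 hLpos hLcont hLslow
  obtain ⟨X₁, h⟩ := eventually_atTop.1
    (hlow.and (hT.eventually_psi_le hξ hr2 hLpos hLcont hLslow))
  obtain ⟨Δ, hΔ, hmono⟩ := hMD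
  set X₀ := max X₁ 2
  have hX₁ : X₁ ≤ X₀ := le_max_left _ _
  have hX2 : 2 ≤ X₀ := le_max_right _ _
  have hX0 : 0 < X₀ := by linarith
  have hTpos := hT.tailFn_pos hLpos
  set p := psi P ξ (1 / X₀)
  have hp : 0 < p := lt_of_lt_of_le (mul_pos hc (hTpos X₀)) (h X₀ hX₁).1
  -- `MD` at `t = 1 / Y` compares `λ = 1 / x` with the fixed `λ = 1 / X₀`. As `x → ∞` the left ratio
  -- stays above a multiple of `Y ^ (-r)`, so the tail cannot be smaller than a pure power.
  have key : ∀ Y, 1 ≤ Y → 1 / Δ < Y → c * p / C ^ 2 * Y ^ (-r) ≤ tailFn P ξ (X₀ * Y) := by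
    intro Y hY1 hYΔ
    have hY0 : 0 < Y := by linarith
    have hmem : 1 / Y ∈ Set.Ico 0 Δ :=
      ⟨by positivity, by rwa [div_lt_iff₀ hY0, mul_comm, ← div_lt_iff₀ hΔ]⟩
    have hlim := (hT.tendsto_tailFn_mul_div hLpos hLcont hLslow hY0).const_mul (c / C)
    have hbound : ∀ᶠ x in atTop, c / C * (tailFn P ξ (Y * x) / tailFn P ξ x) ≤
        C * tailFn P ξ (X₀ * Y) / p := by
      filter_upwards [eventually_ge_atTop X₀] with x hx
      have hx0 : 0 < x := by linarith
      have hxY : x ≤ Y * x := by nlinarith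
      have m1 : 1 / x ∈ Set.Ioo (0 : ℝ) 1 :=
        ⟨by positivity, by rw [div_lt_one hx0]; linarith⟩
      have m2 : 1 / X₀ ∈ Set.Ioo (0 : ℝ) 1 :=
        ⟨by positivity, by rw [div_lt_one hX0]; linarith⟩
      have hm := hmono _ hmem m1 m2 (one_div_le_one_div_of_le hX0 hx)
      simp only at hm
      rw [show 1 / x * (1 / Y) = 1 / (Y * x) by field_simp,
        show 1 / X₀ * (1 / Y) = 1 / (X₀ * Y) by field_simp] at hm
      have a1 := (h (Y * x) (by linarith)).1
      have a2 := (h x (by linarith)).2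
      have a3 := (h (X₀ * Y) (by nlinarith)).2
      have a4 : 0 < psi P ξ (1 / x) :=
        lt_of_lt_of_le (mul_pos hc (hTpos x)) (h x (by linarith)).1
      calc c / C * (tailFn P ξ (Y * x) / tailFn P ξ x)
          = c * tailFn P ξ (Y * x) / (C * tailFn P ξ x) := by
            rw [div_mul_div_comm]
        _ ≤ psi P ξ (1 / (Y * x)) / psi P ξ (1 / x) :=
            div_le_div₀ (psi_nonneg hξ _) a1 a4 a2
        _ ≤ psi P ξ (1 / (X₀ * Y)) / p := hm
        _ ≤ _ := by gcongr
    have := le_of_tendsto hlim hbound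
    rw [le_div_iff₀ hp] at this
    calc c * p / C ^ 2 * Y ^ (-r) = c / C * Y ^ (-r) * p / C := by field_simp
      _ ≤ C * tailFn P ξ (X₀ * Y) / C := by gcongr
      _ = _ := by field_simp
  set d := c * p / C ^ 2 * X₀ ^ r
  have hd : 0 < d := by positivity
  -- With `X₀ * Y = exp y` the bound `key` reads `d ≤ y ^ γ * L y` for all large `y`, which fails
  -- along a sequence when `γ < 0`.
  obtain ⟨y, hy, hyd⟩ := hLslow.exists_rpow_mul_lt hLpos hγ hd
    (max (Real.log (X₀ * (1 / Δ)) + 1) (max (Real.log X₀) 2))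
  have hy1 : Real.log (X₀ * (1 / Δ)) < y := by
    linarith [(le_max_left _ _).trans hy]
  have hy2 : Real.log X₀ ≤ y := ((le_max_left _ _).trans (le_max_right _ _)).trans hy
  have hy3 : 2 ≤ y := ((le_max_right _ _).trans (le_max_right _ _)).trans hy
  have b1 : X₀ * (1 / Δ) < Real.exp y := (Real.log_lt_iff_lt_exp (by positivity)).1 hy1
  have b2 : X₀ ≤ Real.exp y := (Real.log_le_iff_le_exp hX0).1 hy2
  have hk := key (Real.exp y / X₀) ((one_le_div hX0).2 b2) (by
    rw [lt_div_iff₀ hX0, mul_comm]; exact b1)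
  rw [mul_div_cancel₀ _ hX0.ne', hT _ (Real.exp_lt_exp.2 (by linarith)), Real.log_exp,
    Real.div_rpow (Real.exp_pos y).le hX0.le, Real.rpow_neg hX0.le, div_inv_eq_mul] at hk
  have hey : 0 < Real.exp y ^ (-r) := by positivity
  have : Real.exp y ^ (-r) * d ≤ Real.exp y ^ (-r) * (y ^ γ * L y) := by
    simp only [d]
    linarith
  exact absurd (le_of_mul_le_mul_left this hey) (not_le.2 hyd)

/-- A total mass of at most one bounds the power of the logarithm in the tail. -/
theorem HasLogTail.exponent_le (hLpos : ∀ y : ℝ, 1 < y → 0 < L y)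
    (hT : HasLogTail P ξ r γ L) : γ ≤ Real.log (Real.exp 2 ^ r / L 2) / Real.log 2 := by
  -- At `exp 2` the logarithm equals `2`, so this is a bound on `2 ^ γ`. Any point where the
  -- logarithm exceeds `1` would do.
  have h1 := tailFn_le_one P ξ (Real.exp 2)
  have hL := hLpos 2 one_lt_two
  rw [hT _ (Real.exp_lt_exp.2 one_lt_two), Real.log_exp, Real.rpow_neg (Real.exp_pos 2).le,
    mul_assoc, inv_mul_le_iff₀ (by positivity), mul_one, ← le_div_iff₀ hL] at h1
  rw [le_div_iff₀ (Real.log_pos one_lt_two), ← Real.log_rpow two_pos]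
  exact Real.log_le_log (by positivity) h1

/-- A monotone ratio is at most its left limit at `λ = 1`, which continuity identifies because `ψ(1)
≠ 0`. -/
theorem ClassMD.exists_div_le (hξ : AEMeasurable ξ P) (hMD : ClassMD P ξ)
    (h1 : psi P ξ 1 ≠ 0) :
    ∃ Δ : ℝ, 0 < Δ ∧ ∀ t ∈ Set.Ico (0 : ℝ) Δ, ∀ l ∈ Set.Ioo (0 : ℝ) 1,
      psi P ξ (l * t) / psi P ξ l ≤ psi P ξ t / psi P ξ 1 := by
  obtain ⟨Δ, hΔ, hmono⟩ := hMD
  refine ⟨Δ, hΔ, fun t ht l hl => ?_⟩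
  have hψ := continuous_psi hξ
  have hc : ContinuousAt (fun l : ℝ => psi P ξ (l * t) / psi P ξ l) 1 :=
    ContinuousAt.div (by fun_prop) hψ.continuousAt h1
  have hlim : Tendsto (fun l : ℝ => psi P ξ (l * t) / psi P ξ l) (𝓝[<] 1)
      (𝓝 (psi P ξ t / psi P ξ 1)) := by
    have := hc.tendsto.mono_left (nhdsWithin_le_nhds (s := Set.Iio 1))
    simpa using this
  refine ge_of_tendsto hlim ?_
  filter_upwards [Ioo_mem_nhdsLT hl.2] with l' hl'
  exact hmono t ht hl ⟨hl.1.trans hl'.1, hl'.2⟩ hl'.1.le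

end Tail

/-- For the laws under consideration `ψ` is bounded from below on `[1, S]` by a constant that
depends on `r`, `L` and `S` only. -/
theorem exists_pos_le_psi {r : ℝ} (hr0 : 0 < r) (hr2 : r < 2) {L : ℝ → ℝ}
    (hLpos : ∀ y : ℝ, 1 < y → 0 < L y) (hLcont : ContinuousOn L (Set.Ioi 1))
    (hLslow : SlowlyVarying L) (S : ℝ) :
    ∃ κ : ℝ, 0 < κ ∧ ∀ (γ : ℝ) (Ω : Type*) [MeasurableSpace Ω] (P : Measure Ω)
      [IsProbabilityMeasure P] (ξ : Ω → ℝ), AEMeasurable ξ P → HasLogTail P ξ r γ L →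
      ClassMD P ξ → ∀ s ∈ Set.Icc 1 S, κ ≤ psi P ξ s := by
  obtain ⟨κ, hκ, h⟩ := exists_uniform_mul_logTail_sub hr0 hLpos hLcont hLslow
    ((isCompact_Icc (a := 0) (b := Real.log (Real.exp 2 ^ r / L 2) / Real.log 2)).prod
      (isCompact_Icc (a := 1) (b := S))) fun p hp => one_pos.trans_le hp.2.1
  refine ⟨κ, hκ, fun γ Ω _ P _ ξ hξ hT hMD s hs => ?_⟩
  obtain ⟨x₁, x₂, ε, hε, h1, h2, h3, h4⟩ := h (γ, s)
    ⟨⟨hMD.exponent_nonneg hξ hr0 hr2 hLpos hLcont hLslow hT, hT.exponent_le hLpos⟩, hs⟩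
  refine h4.trans (le_trans ?_ (mul_tailFn_sub_le_psi hξ hε h3))
  rw [hT _ h1, hT _ (h1.trans h2)]
  rfl

/-! ### Normed sums under a natural norming. -/

section Norming

variable {Ω : Type*} [MeasurableSpace Ω] {P : Measure Ω} [IsProbabilityMeasure P] {ξ : Ω → ℝ}
  {X : ℕ → Ω → ℝ} {b : ℕ → ℝ}

/-- Since `ψ` is continuous and `ψ(0) = 0`, the norming equation is solvable as soon as `1 / n` does
not exceed `ψ(1)`. -/
theorem IsNaturalNorming.psi_one_div (hξ : AEMeasurable ξ P) (hb : IsNaturalNorming P ξ b)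
    {n : ℕ} (hn : 2 ≤ n) (h : 1 / (n : ℝ) ≤ psi P ξ 1) : psi P ξ (1 / b n) = 1 / n := by
  refine hb.eqn n hn ?_
  have hn0 : (0 : ℝ) < 1 / n := by positivity
  obtain ⟨u, hu, hu'⟩ := intermediate_value_Icc zero_le_one (continuous_psi hξ).continuousOn
    (show 1 / (n : ℝ) ∈ Set.Icc (psi P ξ 0) (psi P ξ 1) from ⟨by rw [psi_zero hξ]; exact hn0.le, h⟩)
  have hu0 : u ≠ 0 := by
    rintro rfl
    rw [psi_zero hξ] at hu'
    exact hn0.ne hu'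
  exact ⟨1 / u, one_div_pos.2 (lt_of_le_of_ne hu.1 hu0.symm), by rwa [one_div_one_div]⟩

/-- For `n` beyond `1 / κ` the tail of the normed sum is controlled by the truncated second moment
of one summand. -/
theorem ClassMD.eventually_tailFn_normedSum_le (hMD : ClassMD P ξ)
    (hsymm : IdentDistrib ξ (fun ω => -ξ ω) P P)
    (hX : ∀ k, IdentDistrib (X k) ξ P P) (hind : iIndepFun X P) (hb : IsNaturalNorming P ξ b)
    {β κ : ℝ} (hβ : 0 < β) (hbβ : ∀ n, 1 ≤ n → β ≤ b n) (hκ : 0 < κ)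
    (hψ : ∀ s ∈ Set.Icc 1 (max 1 (1 / β)), κ ≤ psi P ξ s) :
    ∀ᶠ x in atTop, ∀ n : ℕ, 2 ≤ n → 1 / κ < n →
      tailFn P (normedSum X b n) x ≤ 4 / κ * truncMoment P ξ (x / 4) := by
  have hξ : AEMeasurable ξ P := hsymm.aemeasurable_fst
  have h1 : κ ≤ psi P ξ 1 := hψ 1 ⟨le_rfl, le_max_left _ _⟩
  obtain ⟨Δ, hΔ, hdiv⟩ := hMD.exists_div_le hξ (hκ.trans_le h1).ne'
  filter_upwards [eventually_gt_atTop 0, eventually_gt_atTop (4 / Δ)] with x hx hxΔ n hn hnκ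
  have hn0 : (0 : ℝ) < n := by positivity
  have hnκ' : 1 / (n : ℝ) < κ := (one_div_lt hκ hn0).1 hnκ
  have heq := hb.psi_one_div hξ hn (hnκ'.le.trans h1)
  have hbn := hb.pos n (by omega)
  -- Otherwise `1 / b n` would lie in `[1, 1 / β]`, where `ψ ≥ κ > 1 / n`, against the norming
  -- equation. This is where the lower bound `β` fixes the frequency range for `κ`.
  have hbn1 : 1 / b n < 1 := by
    by_contra! hcon
    have := hψ (1 / b n)
      ⟨hcon, (one_div_le_one_div_of_le hβ (hbβ n (by omega))).trans (le_max_right _ _)⟩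
    linarith
  have hmain : ∀ t : ℝ, |t| ≤ 4 / x →
      n * psi P ξ ((b n)⁻¹ * t) ≤ 2 * truncMoment P ξ (x / 4) / κ := by
    intro t ht
    have hlt : |t| < Δ := ht.trans_lt (by rwa [div_lt_iff₀ hx, mul_comm, ← div_lt_iff₀ hΔ])
    have e : psi P ξ ((b n)⁻¹ * t) = psi P ξ (1 / b n * |t|) := by
      rw [one_div]
      rcases abs_choice t with e | e
      · rw [e]
      · rw [e, mul_neg, psi_neg hξ]
    have := hdiv |t| ⟨abs_nonneg t, hlt⟩ (1 / b n) ⟨by positivity, hbn1⟩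
    rw [heq, div_div_eq_mul_div, div_one, mul_comm, ← e] at this
    refine this.trans (div_le_div₀ ?_ ?_ hκ h1)
    · exact mul_nonneg two_pos.le (integral_nonneg fun ω => by positivity)
    · refine psi_le_two_mul_truncMoment hξ (by positivity) ?_
      rwa [abs_abs, one_div_div]
  refine (tailFn_normedSum_le_integral hsymm hX hind n hx hmain).trans (le_of_eq ?_)
  ring

theorem tailFn_le_uniformTail (hX : ∀ k, IdentDistrib (X k) ξ P P) (hb : b 1 = 1) (x : ℝ) :
    tailFn P ξ x ≤ uniformTail P X b x := by
  have hbdd : BddAbove (Set.range fun n : ℕ+ => tailFn P (normedSum X b n) x) :=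
    ⟨1, by rintro _ ⟨n, rfl⟩; exact tailFn_le_one P _ x⟩
  have h1 : normedSum X b (1 : ℕ+) = X 0 := by
    ext ω
    simp [normedSum, hb]
  calc tailFn P ξ x = tailFn P (normedSum X b (1 : ℕ+)) x := by rw [h1, (hX 0).tailFn_eq]
    _ ≤ _ := le_ciSup hbdd 1

end Norming

/-! ### The two-sided bound. -/

theorem theorem2p3 (r : ℝ) (hr0 : 0 < r) (hr2 : r < 2)
    (L : ℝ → ℝ) (hLpos : ∀ y : ℝ, 1 < y → 0 < L y) (hLcont : ContinuousOn L (Set.Ioi 1))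
    (hLslow : SlowlyVarying L) (β : ℝ) (hβ : 0 < β) :
    ∃ C : ℝ, 0 < C ∧
      ∀ (γ : ℝ) (Ω : Type*) [MeasurableSpace Ω] (P : Measure Ω) [IsProbabilityMeasure P]
        (ξ : Ω → ℝ) (X : ℕ → Ω → ℝ) (b : ℕ → ℝ),
        -- the law of `ξ` is symmetric, has the prescribed tail, and lies in `RT ∩ MD`
        IdentDistrib ξ (fun ω => -ξ ω) P P →
        HasLogTail P ξ r γ L →
        RegularTail P ξ →
        ClassMD P ξ →
        -- independent copies of `ξ` and a natural norming sequence
        (∀ k, IdentDistrib (X k) ξ P P) →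
        iIndepFun X P →
        IsNaturalNorming P ξ b →
        -- `β` is a lower bound of the positive sequence `b(n) → ∞`
        (∀ n : ℕ, 1 ≤ n → β ≤ b n) →
        ∃ x₀ : ℝ, 1 < x₀ ∧ ∀ x : ℝ, x₀ < x →
          tailFn P ξ x ≤ uniformTail P X b x ∧
          uniformTail P X b x ≤ C * tailFn P ξ x := by
  obtain ⟨κ, hκ, hψ⟩ := exists_pos_le_psi hr0 hr2 hLpos hLcont hLslow (max 1 (1 / β))
  have hkar := karamataConst_pos hr2
  -- `K` separates the `n` treated by the union bound from those treated by `MD`; `K ≥ 1` ensures `n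
  -- ≥ 2` in the second range, where the norming equation is available.
  obtain ⟨K, hK⟩ := exists_nat_ge (max 1 (1 / κ))
  have hK1 : (1 : ℝ) ≤ K := (le_max_left _ _).trans hK
  have hK0 : (0 : ℝ) < K := by linarith
  have hc : 0 < β / K := by positivity
  -- `A` serves `n ≤ K` and `B` serves `n > K`. The factor `2` is slack over the limit `c ^ (-r)` of
  -- `T(c x) / T(x)`; neither constant involves `γ`.
  set A := K * (2 * (β / K) ^ (-r))
  set B := 4 / κ * (karamataConst r * (2 * (1 / 4) ^ (-r)))
  have hA : 0 < A := by positivity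
  have hB : 0 < B := by positivity
  refine ⟨A + B, by positivity, fun γ Ω _ P _ ξ X b hsymm hT _ hMD hX hind hb hbβ => ?_⟩
  have hξ : AEMeasurable ξ P := hsymm.aemeasurable_fst
  have hlt : ∀ c : ℝ, 0 < c → c ^ (-r) < 2 * c ^ (-r) := fun c hc => by
    have : 0 < c ^ (-r) := by positivity
    linarith
  have hev := (((hMD.eventually_tailFn_normedSum_le hsymm hX hind hb hβ hbβ hκ
    (hψ γ Ω P ξ hξ hT hMD)).and
    ((tendsto_id.atTop_mul_const (show (0 : ℝ) < 1 / 4 by norm_num)).eventually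
      (hT.eventually_truncMoment_le hξ hr2 hLpos hLcont hLslow))).and
    ((hT.eventually_tailFn_mul_le hLpos hLcont hLslow hc (hlt _ hc)).and
    (hT.eventually_tailFn_mul_le hLpos hLcont hLslow (by norm_num : (0 : ℝ) < 1 / 4)
      (hlt _ (by norm_num))))).and (eventually_gt_atTop 0)
  obtain ⟨x₀, hx₀⟩ := eventually_atTop.1 hev
  refine ⟨max x₀ 2, lt_max_of_lt_right one_lt_two, fun x hx => ?_⟩
  obtain ⟨⟨⟨h1, h2⟩, h3, h4⟩, hx0⟩ := hx₀ x ((le_max_left _ _).trans hx.le)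
  refine ⟨tailFn_le_uniformTail hX hb.one x, ciSup_le fun n => ?_⟩
  have hTx := tailFn_nonneg P ξ x
  have hn1 : 1 ≤ (n : ℕ) := n.pos
  rw [add_mul]
  rcases le_or_gt (n : ℕ) K with hnK | hnK
  · have hnK' : ((n : ℕ) : ℝ) ≤ K := by exact_mod_cast hnK
    have hn0 : (0 : ℝ) < (n : ℕ) := by exact_mod_cast hn1
    calc tailFn P (normedSum X b n) x
        ≤ (n : ℕ) * tailFn P ξ (x * b n / (n : ℕ)) :=
          tailFn_normedSum_le_mul hX hn1 (hb.pos n hn1) x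
      _ ≤ K * tailFn P ξ (β / K * x) := by
          refine mul_le_mul hnK' (tailFn_antitone P ξ ?_) (tailFn_nonneg _ _ _) hK0.le
          rw [div_mul_eq_mul_div, mul_comm β x]
          exact div_le_div₀ (mul_nonneg hx0.le (hb.pos n hn1).le)
            (mul_le_mul_of_nonneg_left (hbβ n hn1) hx0.le) hn0 hnK'
      _ ≤ K * (2 * (β / K) ^ (-r) * tailFn P ξ x) := by gcongr
      _ = A * tailFn P ξ x := by simp only [A]; ring
      _ ≤ _ := le_add_of_nonneg_right (by positivity)
  · have hnK' : (K : ℝ) < (n : ℕ) := by exact_mod_cast hnK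
    have hK1' : 1 ≤ K := by exact_mod_cast hK1
    simp only [id] at h2
    rw [mul_comm] at h4
    calc tailFn P (normedSum X b n) x
        ≤ 4 / κ * truncMoment P ξ (x / 4) :=
          h1 n (by omega) (((le_max_right _ _).trans hK).trans_lt hnK')
      _ ≤ 4 / κ * (karamataConst r * (2 * (1 / 4) ^ (-r) * tailFn P ξ x)) := by
          rw [div_eq_mul_one_div x]
          gcongr
          exact h2.trans (by gcongr)
      _ = B * tailFn P ξ x := by simp only [B]; ring
      _ ≤ _ := le_add_of_nonneg_left (by positivity)
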